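/- **Setting (bilateral trade).** Let $\Theta_S,\Theta_B\subseteq[0,\infty)$ be Borel sets of types. A seller $S$ has a private cost $\theta_S\in\Theta_S$ and a buyer $B$ has a private value $\theta_B\in\Theta_B$, drawn independently from $\mathcal D_S\in\Delta(\Theta_S)$ and $\mathcal D_B\in\Delta(\Theta_B)$, where $\Delta(X)$ denotes the set of probability distributions on $X$. If $S$ posts a price $a\ge 0$, the utilities are $u_S=(a-\theta_S)\mathbf 1\{\theta_B\ge a\}$ and $u_B=(\theta_B-a)\mathbf 1\{\theta_B\ge a\}$. Throughout, a *state* is a pair $(\mathcal D_S,\mathcal D_B)$ such that $\mathcal D_B$ has finite mean (so that the efficient welfare is finite). **Protocols.** A distribution $M\in\Delta(\Delta(X))$ is a *refinement* of $\mathcal D\in\Delta(X)$ if drawing $\mathcal D'\sim M$ and then $x\sim\mathcal D'$ gives $x\sim\mathcal D$. A protocol consists of a price $a^*(\theta_S;\mathcal D_B)$, posted by $S$ when communication is over, and of messages indexed by $t=1,2,\dots$, where $t$ stands for the $t$-th to last round: for odd $t$ (the buyer speaks) a refinement $m^t_B(\mathcal D_S,\mathcal D_B)$ of $\mathcal D_B$,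 for even $t$ (the seller speaks) a refinement $m^t_S(\mathcal D_S,\mathcal D_B)$ of $\mathcal D_S$. The payoffs of $i\in\{S,B\}$ with $t$ rounds are $\pi^0_i(\mathcal D_S,\mathcal D_B)=\mathbb E_{\theta_S\sim\mathcal D_S}\mathbb E_{\theta_B\sim\mathcal D_B}[u_i(a^*(\theta_S;\mathcal D_B),\theta_S,\theta_B)]$, and, for $t\ge1$, $\pi^t_i(\mathcal D_S,\mathcal D_B)=\mathbb E_{\mathcal D_B'\sim m^t_B(\mathcal D_S,\mathcal D_B)}[\pi^{t-1}_i(\mathcal D_S,\mathcal D_B')]$ if $t$ is odd and $\pi^t_i(\mathcal D_S,\mathcal D_B)=\mathbb E_{\mathcal D_S'\sim m^t_S(\mathcal D_S,\mathcal D_B)}[\pi^{t-1}_i(\mathcal D_S',\mathcal D_B)]$ if $t$ is even. **Equilibrium (ties broken in favour of the other agent).** A refinement by the speaker of round $t$ is *voluntary* at a state if it gives each $i\in\{S,B\}$ an expected value of $\pi_i^{t-1}$ at least equal to the value of $\pi_i^{t-1}$ at that state. The protocol is an equilibrium if at every state: for every $\theta_S \in \Theta_S$ the price $a^*(\theta_S;\mathcal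 D_B)$ maximizes $\mathbb E_{\theta_B\sim\mathcal D_B}[u_S]$ over all prices $a\ge0$ and, among the maximizers, maximizes $\mathbb E_{\theta_B\sim\mathcal D_B}[u_B]$; and in every round $t\ge1$ the expectations of $\pi^{t-1}_S$ and $\pi^{t-1}_B$ under every refinement by the speaker exist, and the speaker's message is a voluntary refinement which, among all voluntary refinements, maximizes lexicographically first the speaker's and then the other agent's expected value of $\pi^{t-1}$. **Message complexity.** In an equilibrium $\pi_i^t$ is nondecreasing in $t$; let $\pi_i^\infty=\lim_{t\to\infty}\pi_i^t$, and let $\mathbf C(\mathcal D_S,\mathcal D_B)$ be the least $t\in\mathbb N\cup\{\infty\}$ (where $0\in\mathbb N$) with $\pi_S^t+\pi_B^t=\pi_S^\infty+\pi_B^\infty$ at $(\mathcal D_S,\mathcal D_B)$. **Theorem.** For every equilibrium protocol and every state $(\mathcal D_S,\mathcal D_B)$: if $\mathbf C(\mathcal D_S,\mathcal D_B)=t<\infty$, then the equilibrium allocation after $t$ rounds is efficient, i.e. $$\pi^t_S(\mathcal D_S,\mathcal D_B)+\pi^t_B(\mathcal D_S,\mathcal D_B)=W^*(\mathcal D_S,\mathcal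 D_B):=\mathbb E_{\theta_S\sim\mathcal D_S}\mathbb E_{\theta_B\sim\mathcal D_B}\big[(\theta_B-\theta_S)^+\big].$$ -/

import Mathlib

open MeasureTheory Filter Topology

noncomputable section

namespace BilateralTrade

/-- The two players: Sally (the seller) and Bob (the buyer). -/
inductive Agent
  | S
  | B


open Classical in
/-- Utilities of the base game: Sally posts the price `a`, and Bob buys iff `a ≤ θB`. -/
def utility (i : Agent) (a θS θB : ℝ) : ℝ :=
  match i with
  | .S => if a ≤ θB then a - θS else 0
  | .B => if a ≤ θB then θB - a else 0

/-- `Δ(Θ)`: the probability distributions on the type space `Θ ⊆ ℝ`. -/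
abbrev Distr (Θ : Set ℝ) : Type := ProbabilityMeasure Θ

/-- The distribution has finite mean. -/
def FiniteMean {Θ : Set ℝ} (D : Distr Θ) : Prop :=
  Integrable (fun θ : Θ => (θ : ℝ)) (D : Measure Θ)

/-- `M ∈ Δ(Δ(Θ))` is an information refinement of `D`: sampling `D' ∼ M` and then `θ ∼ D'`
yields the distribution `D`. -/
def Refines {Θ : Set ℝ} (M : ProbabilityMeasure (Distr Θ)) (D : Distr Θ) : Prop :=
  Measure.bind (M : Measure (Distr Θ)) (fun D' => (D' : Measure Θ)) = (D : Measure Θ)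

/-- `x` maximizes `(f, g)` lexicographically over `s`: it maximizes `f` over `s`, and it maximizes
`g` among all maximizers of `f` over `s`. -/
def IsLexMax {α : Type*} (f g : α → ℝ) (s : Set α) (x : α) : Prop :=
  x ∈ s ∧ (∀ y ∈ s, f y ≤ f x) ∧ ∀ y ∈ s, f y = f x → g y ≤ g x

/-- An alternating information refinement protocol of arbitrary length.  The index `t` of a message
means "`t`-th to last": at odd `t` Bob speaks (`msgB t`), at even `t ≥ 2` Sally speaks (`msgS t`);
the remaining values of `msgB` and `msgS` are not used.  When communication is over, Sally with
type `θS` and belief `DB` about Bob posts `price θS DB`. -/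
structure Protocol (ΘS ΘB : Set ℝ) where
  price : ΘS → Distr ΘB → ℝ
  msgB : ℕ → Distr ΘS → Distr ΘB → ProbabilityMeasure (Distr ΘB)
  msgS : ℕ → Distr ΘS → Distr ΘB → ProbabilityMeasure (Distr ΘS)
  msgB_refines : ∀ t DS DB, Refines (msgB t DS DB) DB
  msgS_refines : ∀ t DS DB, Refines (msgS t DS DB) DS

variable {ΘS ΘB : Set ℝ}

/-- Expected utility of agent `i` if Sally has type `θS`, Bob's type is drawn from `DB`, and the
price is `a`. -/
def expUtility (i : Agent) (a : ℝ) (θS : ΘS) (DB : Distr ΘB) : ℝ :=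
  ∫ θB : ΘB, utility i a θS θB ∂(DB : Measure ΘB)

namespace Protocol

/-- `π_i^t(DS, DB)`: expected payoff of agent `i` when the last `t` rounds of the protocol are
played starting from the information `(DS, DB)`. -/
def payoff (P : Protocol ΘS ΘB) : ℕ → Agent → Distr ΘS → Distr ΘB → ℝ
  | 0, i, DS, DB => ∫ θS : ΘS, expUtility i (P.price θS DB) θS DB ∂(DS : Measure ΘS)
  | t + 1, i, DS, DB =>
    if Odd (t + 1) then
      ∫ DB' : Distr ΘB, P.payoff t i DS DB' ∂(P.msgB (t + 1) DS DB : Measure (Distr ΘB))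
    else
      ∫ DS' : Distr ΘS, P.payoff t i DS' DB ∂(P.msgS (t + 1) DS DB : Measure (Distr ΘS))

/-- `E_{DB' ∼ M} [π_i^t(DS, DB')]`. -/
def expB (P : Protocol ΘS ΘB) (t : ℕ) (i : Agent) (DS : Distr ΘS)
    (M : ProbabilityMeasure (Distr ΘB)) : ℝ :=
  ∫ DB' : Distr ΘB, P.payoff t i DS DB' ∂(M : Measure (Distr ΘB))

/-- `E_{DS' ∼ M} [π_i^t(DS', DB)]`. -/
def expS (P : Protocol ΘS ΘB) (t : ℕ) (i : Agent) (DB : Distr ΘB)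
    (M : ProbabilityMeasure (Distr ΘS)) : ℝ :=
  ∫ DS' : Distr ΘS, P.payoff t i DS' DB ∂(M : Measure (Distr ΘS))

/-- Bob's voluntary refinements in round `t + 1`: those which hurt neither player compared with
skipping the round. -/
def VRB (P : Protocol ΘS ΘB) (t : ℕ) (DS : Distr ΘS) (DB : Distr ΘB) :
    Set (ProbabilityMeasure (Distr ΘB)) :=
  {M | Refines M DB ∧ ∀ i, P.payoff t i DS DB ≤ P.expB t i DS M}

/-- Sally's voluntary refinements in round `t + 1`. -/
def VRS (P : Protocol ΘS ΘB) (t : ℕ) (DS : Distr ΘS) (DB : Distr ΘB) :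
    Set (ProbabilityMeasure (Distr ΘS)) :=
  {M | Refines M DS ∧ ∀ i, P.payoff t i DS DB ≤ P.expS t i DB M}

/-- The protocol is an equilibrium in which each agent breaks ties in favour of the other one.
The conditions are imposed at all states in which Bob's value has finite mean (the states with a
finite efficient welfare):
* Sally's price maximizes her own expected utility and, among such prices, Bob's;
* in every round, the expected continuation payoffs after any refinement by the speaker exist;
* in every round, the speaker's message is voluntary and, among the voluntary refinements, it
  maximizes lexicographically the speaker's and then the listener's expected payoff. -/
structure IsEquilibrium (P : Protocol ΘS ΘB) : Prop where
  price_opt : ∀ (θS : ΘS) (DB : Distr ΘB), FiniteMean DB →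
    IsLexMax (fun a => expUtility .S a θS DB) (fun a => expUtility .B a θS DB)
      {a : ℝ | 0 ≤ a} (P.price θS DB)
  integrableB : ∀ t : ℕ, Odd (t + 1) → ∀ (DS : Distr ΘS) (DB : Distr ΘB), FiniteMean DB →
    ∀ M : ProbabilityMeasure (Distr ΘB), Refines M DB → ∀ i,
      Integrable (fun DB' => P.payoff t i DS DB') (M : Measure (Distr ΘB))
  integrableS : ∀ t : ℕ, Even (t + 1) → ∀ (DS : Distr ΘS) (DB : Distr ΘB), FiniteMean DB →
    ∀ M : ProbabilityMeasure (Distr ΘS), Refines M DS → ∀ i,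
      Integrable (fun DS' => P.payoff t i DS' DB) (M : Measure (Distr ΘS))
  msgB_opt : ∀ t : ℕ, Odd (t + 1) → ∀ (DS : Distr ΘS) (DB : Distr ΘB), FiniteMean DB →
    IsLexMax (P.expB t .B DS) (P.expB t .S DS) (P.VRB t DS DB) (P.msgB (t + 1) DS DB)
  msgS_opt : ∀ t : ℕ, Even (t + 1) → ∀ (DS : Distr ΘS) (DB : Distr ΘB), FiniteMean DB →
    IsLexMax (P.expS t .S DB) (P.expS t .B DB) (P.VRS t DS DB) (P.msgS (t + 1) DS DB)

/-- `π_i^t(DS, DB)` for `t ∈ ℕ ∪ {∞}`, where `π_i^∞` is the limit of `π_i^t` as `t → ∞`.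
In an equilibrium the sequence is monotone and bounded at every state in which Bob's value has
finite mean, so that the limit exists there. -/
def payoffE (P : Protocol ΘS ΘB) (t : ℕ∞) (i : Agent) (DS : Distr ΘS) (DB : Distr ΘB) : ℝ :=
  match t with
  | (n : ℕ) => P.payoff n i DS DB
  | ⊤ => limUnder atTop (fun n : ℕ => P.payoff n i DS DB)

/-- The message complexity `C(DS, DB) ∈ ℕ ∪ {∞}`. -/
def messageComplexity (P : Protocol ΘS ΘB) (DS : Distr ΘS) (DB : Distr ΘB) : ℕ∞ :=
  sInf {t : ℕ∞ | P.payoffE t .S DS DB + P.payoffE t .B DS DB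
    = P.payoffE ⊤ .S DS DB + P.payoffE ⊤ .B DS DB}

end Protocol

/-- `W*(DS, DB)`: the expected welfare under efficient trade. -/
def efficientWelfare (DS : Distr ΘS) (DB : Distr ΘB) : ℝ :=
  ∫ θS : ΘS, ∫ θB : ΘB, max ((θB : ℝ) - (θS : ℝ)) 0 ∂(DB : Measure ΘB) ∂(DS : Measure ΘS)

end BilateralTrade

end

open scoped NNReal ENNReal

namespace BilateralTrade

variable {Θ ΘS ΘB : Set ℝ}

/-! If `t` rounds already give the limiting welfare, then no longer protocol improves either payoff,
since both are nondecreasing in the number of rounds (`IsStable`). Efficiency then follows by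
induction on `t`.

The inductive step peels off the first message `M`. In a longer protocol with the same speaker,
sending `M` again is voluntary and at least as good as before. Since the optimum has not improved,
the lexicographic tie-breaking forces both continuation payoffs to agree at almost every posterior,
so almost every posterior is stable with one round fewer (`ae_isStable_msgS`, `ae_isStable_msgB`).
Payoffs and efficient welfare both average over posteriors.

At `t = 0`, Sally could reveal her cost in a two-round protocol (`efficient_of_payoff_two_eq`). For
a known cost `c` with monopoly profit `R`, Bob's message guarantees Sally at least `R`, and it can
give Bob all remaining welfare up to any `δ > 0` (`Attainable.welfare_sub_profit`). One message is
thus efficient, and since two rounds bring no gain, the initial state was efficient.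

The segmentation starts from the types above the monopoly price and adds lower types over
geometrically shrinking intervals. A new type is the lowest of its segment, and the higher types
mixed in are just few enough to keep it an optimal price. The loss relative to full surplus does not
accumulate from one interval to the next (`Attainable.tail_step`). -/

/-! ### Averaging integrals over a refinement. -/

lemma measurable_distr_coe : Measurable (fun D : Distr Θ => (D : Measure Θ)) :=
  measurable_subtype_coe

/-- The tautological kernel from distributions to types. -/
noncomputable def distrKernel (Θ : Set ℝ) : ProbabilityTheory.Kernel (Distr Θ) Θ :=
  ⟨fun D => (D : Measure Θ), measurable_distr_coe⟩

instance : ProbabilityTheory.IsMarkovKernel (distrKernel Θ) :=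
  ⟨fun D => inferInstanceAs (IsProbabilityMeasure (D : Measure Θ))⟩

lemma ae_integrable_of_bind {M : Measure (Distr Θ)} [SFinite M] {μ : Measure Θ}
    (h : M.bind (fun D : Distr Θ => (D : Measure Θ)) = μ) {f : Θ → ℝ} (hf : Integrable f μ) :
    ∀ᵐ D : Distr Θ ∂M, Integrable f (D : Measure Θ) := by
  subst h
  exact Measure.ae_integrable_of_integrable_comp (κ := distrKernel Θ) hf

lemma integrable_integral_of_bind {M : Measure (Distr Θ)} [SFinite M] {μ : Measure Θ}
    (h : M.bind (fun D : Distr Θ => (D : Measure Θ)) = μ) {f : Θ → ℝ} (hf : Integrable f μ) :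
    Integrable (fun D : Distr Θ => ∫ x, f x ∂(D : Measure Θ)) M := by
  subst h
  have := ((Measure.integrable_compProd_snd_iff (μ := M) (κ := distrKernel Θ)
    hf.aestronglyMeasurable).2 hf).integral_compProd
  exact this

lemma integral_of_bind {M : Measure (Distr Θ)} [SFinite M] {μ : Measure Θ}
    (h : M.bind (fun D : Distr Θ => (D : Measure Θ)) = μ) {f : Θ → ℝ} (hf : Integrable f μ) :
    ∫ D : Distr Θ, ∫ x, f x ∂(D : Measure Θ) ∂M = ∫ x, f x ∂μ := by
  subst h
  have h1 := (Measure.integrable_compProd_snd_iff (μ := M) (κ := distrKernel Θ)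
    hf.aestronglyMeasurable).2 hf
  have h2 := Measure.integral_compProd h1
  have h3 : M.bind (fun D : Distr Θ => (D : Measure Θ)) = (M.compProd (distrKernel Θ)).map Prod.snd :=
    (Measure.snd_compProd M (distrKernel Θ)).symm
  rw [h3] at hf ⊢
  rw [integral_map measurable_snd.aemeasurable hf.aestronglyMeasurable]
  exact h2.symm

/-! ### Expected utilities at a posted price. -/

/-- The event that the type is at least `a`. -/
def tail (Θ : Set ℝ) (a : ℝ) : Set Θ := {v | a ≤ (v : ℝ)}

lemma measurableSet_tail (a : ℝ) : MeasurableSet (tail Θ a) :=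
  measurableSet_le measurable_const measurable_subtype_coe

lemma tail_anti {a b : ℝ} (h : a ≤ b) : tail Θ b ⊆ tail Θ a := fun _ hv => h.trans hv

lemma utility_S_eq (a c : ℝ) (v : Θ) :
    utility .S a c v = (tail Θ a).indicator (fun _ => a - c) v := by
  simp only [utility, tail, Set.indicator, Set.mem_ofPred_eq]
  congr

lemma utility_B_eq (a c v : ℝ) : utility .B a c v = max (v - a) 0 := by
  unfold utility
  split_ifs with h
  · rw [max_eq_left (by linarith)]
  · rw [max_eq_right (by linarith)]

lemma integrable_max_sub {μ : Measure Θ} [IsFiniteMeasure μ]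
    (hμ : Integrable (fun v : Θ => (v : ℝ)) μ) (a : ℝ) :
    Integrable (fun v : Θ => max ((v : ℝ) - a) 0) μ :=
  (hμ.sub (integrable_const a)).pos_part

lemma expUtility_S_eq (a : ℝ) (c : ΘS) (D : Distr ΘB) :
    expUtility .S a c D = (a - c) * (D : Measure ΘB).real (tail ΘB a) := by
  simp only [expUtility, utility_S_eq]
  rw [integral_indicator_const _ (measurableSet_tail a), smul_eq_mul, mul_comm]

lemma expUtility_B_eq (a : ℝ) (c : ΘS) (D : Distr ΘB) :
    expUtility .B a c D = ∫ v : ΘB, max ((v : ℝ) - a) 0 ∂(D : Measure ΘB) := by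
  simp only [expUtility, utility_B_eq]

lemma expUtility_B_nonneg (a : ℝ) (c : ΘS) (D : Distr ΘB) : 0 ≤ expUtility .B a c D := by
  rw [expUtility_B_eq]
  exact integral_nonneg fun _ => le_max_right _ _

lemma expUtility_add_le (a : ℝ) (c : ΘS) (D : Distr ΘB) (hD : FiniteMean D) :
    expUtility .S a c D + expUtility .B a c D
      ≤ ∫ v : ΘB, max ((v : ℝ) - c) 0 ∂(D : Measure ΘB) := by
  have h1 : Integrable (fun v : ΘB => utility .S a c v) (D : Measure ΘB) := by
    simp only [utility_S_eq]
    exact (integrable_const _).indicator (measurableSet_tail a)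
  have h2 : Integrable (fun v : ΘB => utility .B a c v) (D : Measure ΘB) := by
    simp only [utility_B_eq]
    exact integrable_max_sub hD a
  unfold expUtility
  rw [← integral_add h1 h2]
  refine integral_mono (h1.add h2) (integrable_max_sub hD c) fun v => ?_
  simp only [utility]
  split_ifs with h
  · exact le_trans (by linarith) (le_max_left _ _)
  · exact le_trans (by linarith) (le_max_right _ _)

/-! ### Calculus of segmentations; markets are unnormalized so that they can be added and scaled. -/

/-- A payoff of Bob as a function of Sally's belief which is integrable under every refinement and
which is at least his payoff from any price that is optimal for Sally, her cost being `c`. -/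
structure IsBuyerPayoff (c : ℝ) (u : Distr Θ → ℝ) : Prop where
  nonneg : ∀ D, 0 ≤ u D
  le_of_optimal : ∀ D, FiniteMean D → ∀ a, 0 ≤ a →
    (∀ p, 0 ≤ p → (p - c) * (D : Measure Θ).real (tail Θ p)
      ≤ (a - c) * (D : Measure Θ).real (tail Θ a)) →
    ∫ v : Θ, max ((v : ℝ) - a) 0 ∂(D : Measure Θ) ≤ u D
  integrable : ∀ D, FiniteMean D → ∀ M : ProbabilityMeasure (Distr Θ), Refines M D →
    Integrable u (M : Measure (Distr Θ))

/-- Some segmentation of the market `μ` gives Bob at least `b`. -/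
def Attainable (u : Distr Θ → ℝ) (μ : Measure Θ) (b : ℝ) : Prop :=
  ∃ M : Measure (Distr Θ), M.bind (fun D : Distr Θ => (D : Measure Θ)) = μ ∧ b ≤ ∫ D, u D ∂M

lemma univ_of_bind {M : Measure (Distr Θ)} {μ : Measure Θ}
    (h : M.bind (fun D : Distr Θ => (D : Measure Θ)) = μ) : M Set.univ = μ Set.univ := by
  subst h
  rw [Measure.bind_apply MeasurableSet.univ measurable_distr_coe.aemeasurable]
  simp

namespace IsBuyerPayoff

variable {c : ℝ} {u : Distr Θ → ℝ}

/-- Dividing by the common total mass reduces this to refinements of a probability distribution;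
total mass zero is trivial. -/
lemma integrable_of_bind (hu : IsBuyerPayoff c u) {M : Measure (Distr Θ)} {μ : Measure Θ}
    [IsFiniteMeasure μ] (hμ : Integrable (fun v : Θ => (v : ℝ)) μ)
    (h : M.bind (fun D : Distr Θ => (D : Measure Θ)) = μ) : Integrable u M := by
  by_cases h0 : μ Set.univ = 0
  · have : M = 0 := by rw [← Measure.measure_univ_eq_zero, univ_of_bind h, h0]
    simp [this]
  have hfin : μ Set.univ ≠ ∞ := measure_ne_top _ _
  set r := (μ Set.univ)⁻¹ with hr
  have hr0 : r ≠ 0 := ENNReal.inv_ne_zero.2 hfin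
  have hrt : r ≠ ∞ := ENNReal.inv_ne_top.2 h0
  have hM : IsProbabilityMeasure (r • M) := ⟨by
    simp [univ_of_bind h, hr, ENNReal.inv_mul_cancel h0 hfin]⟩
  have hμ' : IsProbabilityMeasure (r • μ) := ⟨by
    simp [hr, ENNReal.inv_mul_cancel h0 hfin]⟩
  have := hu.integrable ⟨r • μ, hμ'⟩ (hμ.smul_measure hrt) ⟨r • M, hM⟩
    (show (r • M).bind _ = r • μ by rw [Measure.bind_smul, ← h])
  exact (integrable_smul_measure hr0 hrt).1 this

end IsBuyerPayoff

namespace Attainable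

variable {c : ℝ} {u : Distr Θ → ℝ}

lemma mono {μ : Measure Θ} {b b' : ℝ} (h : Attainable u μ b) (hb : b' ≤ b) : Attainable u μ b' :=
  let ⟨M, h1, h2⟩ := h
  ⟨M, h1, hb.trans h2⟩

lemma add (hu : IsBuyerPayoff c u) {μ ν : Measure Θ} [IsFiniteMeasure μ] [IsFiniteMeasure ν]
    (hμ : Integrable (fun v : Θ => (v : ℝ)) μ) (hν : Integrable (fun v : Θ => (v : ℝ)) ν)
    {b b' : ℝ} (h : Attainable u μ b) (h' : Attainable u ν b') :
    Attainable u (μ + ν) (b + b') := by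
  obtain ⟨M, hM, hb⟩ := h
  obtain ⟨N, hN, hb'⟩ := h'
  refine ⟨M + N, ?_, ?_⟩
  · rw [← hM, ← hN]
    ext s hs
    simp only [Measure.bind_apply hs measurable_distr_coe.aemeasurable, lintegral_add_measure,
      Measure.add_apply]
  · rw [integral_add_measure (hu.integrable_of_bind hμ hM) (hu.integrable_of_bind hν hN)]
    exact add_le_add hb hb'

lemma smul {μ : Measure Θ} {b : ℝ} (h : Attainable u μ b) (r : ℝ≥0) :
    Attainable u (r • μ) (r * b) := by
  obtain ⟨M, hM, hb⟩ := h
  refine ⟨r • M, ?_, ?_⟩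
  · rw [Measure.bind_smul, hM]
  · rw [integral_smul_nnreal_measure]
    exact mul_le_mul_of_nonneg_left hb r.2

/-- The segmentation is the image of `μ` under `σ`. Only the lower bound `g` on Bob's payoff is
known explicitly; integrability of `u ∘ σ` comes from `hu`. -/
lemma of_family (hu : IsBuyerPayoff c u) {μ : Measure Θ} {σ : Θ → Distr Θ} (hσ : Measurable σ)
    [IsFiniteMeasure (μ.bind fun v => (σ v : Measure Θ))]
    (hint : Integrable (fun v : Θ => (v : ℝ)) (μ.bind fun v => (σ v : Measure Θ)))
    {g : Θ → ℝ} (hg : Integrable g μ) (hgu : ∀ᵐ v ∂μ, g v ≤ u (σ v)) :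
    Attainable u (μ.bind fun v => (σ v : Measure Θ)) (∫ v, g v ∂μ) := by
  have hbind : (μ.map σ).bind (fun D : Distr Θ => (D : Measure Θ))
      = μ.bind fun v => (σ v : Measure Θ) := by
    rw [Measure.bind, Measure.map_map measurable_distr_coe hσ]; rfl
  have h := hu.integrable_of_bind hint hbind
  refine ⟨μ.map σ, hbind, ?_⟩
  rw [integral_map hσ.aemeasurable h.aestronglyMeasurable]
  exact integral_mono_ae hg (h.comp_measurable hσ) hgu

end Attainable

/-! ### Segments with a distinguished type. -/

section

/-- The market consisting of `a` times the part of `F` on `A`, and of mass `b` at the type `v`. -/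
noncomputable def segment (F : Distr Θ) (A : Set Θ) (a b : ℝ≥0)
    (h : a * (F : Measure Θ) A + b = 1) (v : Θ) : Distr Θ :=
  ⟨a • (F : Measure Θ).restrict A + b • Measure.dirac v, ⟨by
    rw [Measure.add_apply, Measure.smul_apply, Measure.smul_apply, Measure.restrict_apply_univ,
      measure_univ, ENNReal.smul_def, ENNReal.smul_def, smul_eq_mul, smul_eq_mul, mul_one, h]⟩⟩

variable {F : Distr Θ} {A : Set Θ} {a b : ℝ≥0} {h : a * (F : Measure Θ) A + b = 1}

lemma segment_coe (v : Θ) : (segment F A a b h v : Measure Θ)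
    = a • (F : Measure Θ).restrict A + b • Measure.dirac v := rfl

lemma measurable_segment : Measurable (segment F A a b h) := by
  refine Measurable.subtype_mk (Measure.measurable_of_measurable_coe _ fun s hs => ?_)
  simp only [Measure.add_apply, Measure.smul_apply, Measure.dirac_apply' _ hs]
  exact measurable_const.add ((measurable_one.indicator hs).const_smul b)

/-- The part on `A` is common to all segments and is counted once per unit of `μ`; the point masses
average to `μ`. -/
lemma bind_segment (μ : Measure Θ) :
    μ.bind (fun v => (segment F A a b h v : Measure Θ))
      = (μ Set.univ * a) • (F : Measure Θ).restrict A + b • μ := by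
  ext s hs
  have hm : Measurable fun v => (segment F A a b h v : Measure Θ) :=
    measurable_distr_coe.comp measurable_segment
  rw [Measure.bind_apply hs hm.aemeasurable]
  simp only [segment_coe, Measure.add_apply, Measure.smul_apply, Measure.dirac_apply' _ hs,
    ENNReal.smul_def, smul_eq_mul]
  rw [lintegral_add_left measurable_const, lintegral_const,
    lintegral_const_mul _ (measurable_one.indicator hs), lintegral_indicator_one hs]
  ring

lemma finiteMean_segment (hF : FiniteMean F) (v : Θ) : FiniteMean (segment F A a b h v) :=
  ((Integrable.restrict hF).smul_measure_nnreal).add_measure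
    ((integrable_dirac (by simp)).smul_measure_nnreal)

lemma integral_segment {f : Θ → ℝ} (hf : Integrable f (F : Measure Θ)) (v : Θ) :
    ∫ x, f x ∂(segment F A a b h v : Measure Θ)
      = a * ∫ x in A, f x ∂(F : Measure Θ) + b * f v := by
  rw [segment_coe, integral_add_measure (hf.restrict.smul_measure_nnreal)
    ((integrable_dirac (by simp)).smul_measure_nnreal)]
  rw [integral_smul_nnreal_measure, integral_smul_nnreal_measure, integral_dirac]
  rfl

lemma segment_real_tail_of_lt {v : Θ} {p : ℝ} (hp : (v : ℝ) < p) :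
    (segment F A a b h v : Measure Θ).real (tail Θ p)
      = a * (F : Measure Θ).real (tail Θ p ∩ A) := by
  have h0 : v ∉ tail Θ p := by simpa [tail] using hp
  rw [segment_coe, measureReal_def, Measure.add_apply, Measure.smul_apply, Measure.smul_apply,
    Measure.dirac_apply' _ (measurableSet_tail p), Measure.restrict_apply (measurableSet_tail p)]
  simp [h0, ENNReal.smul_def, measureReal_def]

lemma segment_real_tail_self {v : Θ} (hA : A ⊆ tail Θ v) :
    (segment F A a b h v : Measure Θ).real (tail Θ v) = 1 := by
  have h0 : v ∈ tail Θ v := le_refl (v : ℝ)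
  rw [segment_coe, measureReal_def, Measure.add_apply, Measure.smul_apply, Measure.smul_apply,
    Measure.dirac_apply' _ (measurableSet_tail _), Measure.restrict_apply (measurableSet_tail _),
    Set.inter_eq_right.2 hA]
  simp only [ENNReal.smul_def, smul_eq_mul, Set.indicator_of_mem h0, Pi.one_apply, mul_one, h]
  rfl

variable {c : ℝ} {u : Distr Θ → ℝ}

/-- If the types in `A` are above `v`, and Sally's profit from them is small, then `v` is an optimal
price in the segment. -/
lemma IsBuyerPayoff.le_segment (hu : IsBuyerPayoff c u) (hF : FiniteMean F) {R : ℝ}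
    (hR : ∀ p, c ≤ p → (p - c) * (F : Measure Θ).real (tail Θ p) ≤ R) {v : Θ}
    (hA : A ⊆ tail Θ v) (hv0 : 0 ≤ (v : ℝ)) (hv : a * R ≤ v - c) (hcv : c ≤ v) :
    a * ∫ x in A, max ((x : ℝ) - v) 0 ∂(F : Measure Θ) ≤ u (segment F A a b h v) := by
  have := hu.le_of_optimal (segment F A a b h v) (finiteMean_segment hF v) v hv0 fun p _ => ?_
  · rwa [integral_segment (integrable_max_sub hF v), sub_self, max_self, mul_zero,
      add_zero] at this
  rw [segment_real_tail_self hA, mul_one]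
  -- Price `v` sells to the whole segment and earns `v - c`. A lower price earns no more, and a
  -- higher one sells only to the part on `A`, earning at most `a * R`.
  rcases le_or_gt p v with hp | hp
  · rcases le_or_gt c p with hc | hc
    · calc (p - c) * _ ≤ (p - c) * 1 :=
            mul_le_mul_of_nonneg_left measureReal_le_one (by linarith)
        _ ≤ _ := by linarith
    · have := mul_nonpos_of_nonpos_of_nonneg (by linarith : p - c ≤ 0)
        (measureReal_nonneg (μ := (segment F A a b h v : Measure Θ)) (s := tail Θ p))
      linarith
  · rw [segment_real_tail_of_lt hp]
    have h1 : (F : Measure Θ).real (tail Θ p ∩ A) ≤ (F : Measure Θ).real (tail Θ p) :=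
      measureReal_mono Set.inter_subset_left
    have h2 := mul_le_mul_of_nonneg_left h1 (by linarith : 0 ≤ p - c)
    have h3 := mul_le_mul_of_nonneg_left (h2.trans (hR p (by linarith))) a.2
    calc (p - c) * (a * (F : Measure Θ).real (tail Θ p ∩ A))
        = a * ((p - c) * (F : Measure Θ).real (tail Θ p ∩ A)) := by ring
      _ ≤ a * R := h3
      _ ≤ _ := hv

end

/-! ### The segmentation that leaves Bob almost all welfare above the monopoly profit. -/

section

variable {F : Distr Θ} {c : ℝ} {u : Distr Θ → ℝ}

lemma integral_sub_const_restrict (hF : FiniteMean F) (A : Set Θ) (x y : ℝ) :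
    ∫ v in A, ((v : ℝ) - x) ∂(F : Measure Θ)
      = ∫ v in A, ((v : ℝ) - y) ∂(F : Measure Θ) - (x - y) * (F : Measure Θ).real A := by
  rw [integral_sub hF.restrict (integrable_const _), integral_sub hF.restrict (integrable_const _),
    setIntegral_const, setIntegral_const]
  simp only [smul_eq_mul]
  ring

lemma setIntegral_max_sub {A : Set Θ} (hA : MeasurableSet A) {x : ℝ} (h : A ⊆ tail Θ x) :
    ∫ v in A, max ((v : ℝ) - x) 0 ∂(F : Measure Θ) = ∫ v in A, ((v : ℝ) - x) ∂(F : Measure Θ) :=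
  setIntegral_congr_fun hA fun _ hv => max_eq_left (sub_nonneg.2 (h hv))

/-- The types above Sally's optimal price can be kept in a single segment. -/
lemma Attainable.tail_price (hu : IsBuyerPayoff c u) (hF : FiniteMean F) {s : ℝ} (hs0 : 0 ≤ s)
    (hcs : c < s) (hpos : 0 < (F : Measure Θ).real (tail Θ s))
    (hR : ∀ p, c ≤ p → (p - c) * (F : Measure Θ).real (tail Θ p)
      ≤ (s - c) * (F : Measure Θ).real (tail Θ s)) :
    Attainable u ((F : Measure Θ).restrict (tail Θ s))
      (∫ v in tail Θ s, ((v : ℝ) - c) ∂(F : Measure Θ)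
        - (s - c) * (F : Measure Θ).real (tail Θ s)) := by
  set A := tail Θ s with hA
  -- With this normalization and `b = 0`, the segment is `F` conditioned on `A`, whatever the
  -- distinguished type.
  set a : ℝ≥0 := (F A)⁻¹ with ha
  have hFA : ((F A : ℝ≥0) : ℝ≥0∞) = (F : Measure Θ) A :=
    ProbabilityMeasure.ennreal_coeFn_eq_coeFn_toMeasure F A
  have hFAr : ((F A : ℝ≥0) : ℝ) = (F : Measure Θ).real A := rfl
  have hne : F A ≠ 0 := by
    intro h
    rw [← hFAr, h] at hpos
    simp at hpos
  have h : a * (F : Measure Θ) A + ((0 : ℝ≥0) : ℝ≥0∞) = 1 := by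
    rw [← hFA, ← ENNReal.coe_mul, ha, inv_mul_cancel₀ hne]; simp
  have har : (a : ℝ) * (F : Measure Θ).real A = 1 := by
    rw [← hFAr, ← NNReal.coe_mul, ha, inv_mul_cancel₀ hne]; simp
  have hbind : ((F : Measure Θ).restrict A).bind (fun v => (segment F A a 0 h v : Measure Θ))
      = (F : Measure Θ).restrict A := by
    rw [bind_segment, Measure.restrict_apply_univ, mul_comm]
    simp only [ENNReal.coe_zero, add_zero] at h
    rw [h]; simp
  have htail : ∀ v p, (segment F A a 0 h v : Measure Θ).real (tail Θ p)
      = a * (F : Measure Θ).real (tail Θ p ∩ A) := by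
    intro v p
    rw [segment_coe, measureReal_def, Measure.add_apply, Measure.smul_apply,
      Measure.restrict_apply (measurableSet_tail p)]
    simp [ENNReal.smul_def, measureReal_def]
  have key : ∀ v, a * ∫ x in A, ((x : ℝ) - s) ∂(F : Measure Θ) ≤ u (segment F A a 0 h v) := by
    intro v
    have := hu.le_of_optimal (segment F A a 0 h v) (finiteMean_segment hF v) s hs0 fun p _ => ?_
    · rw [integral_segment (integrable_max_sub hF s), setIntegral_max_sub (measurableSet_tail s)
        subset_rfl] at this
      simpa using this
    rw [htail, htail, Set.inter_self, har, mul_one]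
    rcases le_or_gt c p with hc | hc
    · have h1 : (F : Measure Θ).real (tail Θ p ∩ A) ≤ (F : Measure Θ).real (tail Θ p) :=
        measureReal_mono Set.inter_subset_left
      have h2 := mul_le_mul_of_nonneg_left h1 (by linarith : 0 ≤ p - c)
      have h3 := mul_le_mul_of_nonneg_left (h2.trans (hR p hc)) a.2
      calc (p - c) * (a * (F : Measure Θ).real (tail Θ p ∩ A))
          = a * ((p - c) * (F : Measure Θ).real (tail Θ p ∩ A)) := by ring
        _ ≤ a * ((s - c) * (F : Measure Θ).real A) := h3
        _ = s - c := by rw [mul_left_comm, har, mul_one]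
    · have := mul_nonpos_of_nonpos_of_nonneg (by linarith : p - c ≤ 0)
        (mul_nonneg a.2 (measureReal_nonneg (μ := (F : Measure Θ)) (s := tail Θ p ∩ A)))
      exact this.trans (by linarith)
  have hfin : IsFiniteMeasure
      (((F : Measure Θ).restrict A).bind fun v => (segment F A a 0 h v : Measure Θ)) := by
    rw [hbind]; infer_instance
  have := Attainable.of_family hu (measurable_segment (h := h)) (μ := (F : Measure Θ).restrict A)
    (by rw [hbind]; exact hF.restrict)
    (integrable_const (a * ∫ x in A, ((x : ℝ) - s) ∂(F : Measure Θ))) (ae_of_all _ key)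
  rw [hbind, setIntegral_const, smul_eq_mul, ← mul_assoc, mul_comm _ (a : ℝ), har, one_mul,
    integral_sub_const_restrict hF A s c] at this
  exact this

/-- Types in `[s, t)` are added to the market one by one, each as the lowest type of a segment whose
other types are drawn from the market above `t`. -/
lemma Attainable.tail_step (hu : IsBuyerPayoff c u) (hF : FiniteMean F) (hc0 : 0 ≤ c)
    {R L s t : ℝ} (hR0 : 0 < R) (hcs : c < s) (hst : s < t)
    (hR : ∀ p, c ≤ p → (p - c) * (F : Measure Θ).real (tail Θ p) ≤ R)
    (hL : (t - c) * R ≤ (s - c) * L)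
    (h : Attainable u ((F : Measure Θ).restrict (tail Θ t))
      (∫ v in tail Θ t, ((v : ℝ) - c) ∂(F : Measure Θ) - L)) :
    Attainable u ((F : Measure Θ).restrict (tail Θ s))
      (∫ v in tail Θ s, ((v : ℝ) - c) ∂(F : Measure Θ) - L) := by
  set A := tail Θ t with hA
  set C := tail Θ s \ A with hC
  have hAm : MeasurableSet A := measurableSet_tail t
  have hCm : MeasurableSet C := (measurableSet_tail s).diff hAm
  have hAs : A ⊆ tail Θ s := tail_anti hst.le
  have hdisj : Disjoint A C := Set.disjoint_sdiff_right
  have hunion : A ∪ C = tail Θ s := Set.union_sdiff_cancel hAs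
  have hFA : ((F A : ℝ≥0) : ℝ≥0∞) = (F : Measure Θ) A :=
    ProbabilityMeasure.ennreal_coeFn_eq_coeFn_toMeasure F A
  have hFC : ((F C : ℝ≥0) : ℝ≥0∞) = (F : Measure Θ) C :=
    ProbabilityMeasure.ennreal_coeFn_eq_coeFn_toMeasure F C
  set fA : ℝ≥0 := F A with hfA
  set fC : ℝ≥0 := F C with hfC
  have hFAr : (F : Measure Θ).real A = fA := rfl
  have hFCr : (F : Measure Θ).real C = fC := rfl
  have hsum : (F : Measure Θ).real (tail Θ s) = fA + fC := by
    rw [← hunion, measureReal_union hdisj hCm]; rfl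
  -- Chosen so that `a * R = s - c`: prices above the new type `v ≥ s` then earn at most `s - c ≤ v
  -- - c`.
  obtain ⟨a, ha⟩ : ∃ a : ℝ≥0, (a : ℝ) = (s - c) / R :=
    ⟨⟨(s - c) / R, div_nonneg (by linarith) hR0.le⟩, rfl⟩
  have haR : (a : ℝ) * R = s - c := by rw [ha]; field_simp
  have haA : a * fA < 1 := by
    rw [← NNReal.coe_lt_coe]
    push_cast
    have h1 := hR t (by linarith)
    rw [hFAr] at h1
    rw [ha, div_mul_eq_mul_div, div_lt_one hR0]
    rcases eq_or_lt_of_le fA.2 with h0 | h0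
    · have : (fA : ℝ) = 0 := h0.symm
      rw [this]; simpa using hR0
    · exact lt_of_lt_of_le (mul_lt_mul_of_pos_right (by linarith) h0) h1
  have haS : a * fA + a * fC ≤ 1 := by
    rw [← NNReal.coe_le_coe]
    push_cast
    have h1 := hR s hcs.le
    rw [hsum] at h1
    rw [← mul_add, ha, div_mul_eq_mul_div, div_le_one hR0]
    exact h1
  obtain ⟨b, hb⟩ : ∃ b : ℝ≥0, a * fA + b = 1 := ⟨1 - a * fA, add_tsub_cancel_of_le haA.le⟩
  have hb0 : b ≠ 0 := by
    rintro rfl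
    rw [add_zero] at hb
    exact haA.ne hb
  have haCb : a * fC ≤ b := by
    rw [← hb] at haS
    exact le_of_add_le_add_left haS
  -- Each segment holds mass `b` at its new type, so the family is scaled by `b⁻¹` to recover `F` on
  -- `C`. This consumes a fraction `b⁻¹ * a * fC` of the market on `A`; the rest `q` keeps the old
  -- segmentation.
  have hN : b⁻¹ * (a * fC) ≤ 1 := by
    rw [← inv_mul_cancel₀ hb0]
    gcongr
  obtain ⟨q, hq⟩ : ∃ q : ℝ≥0, b⁻¹ * (a * fC) + q = 1 :=
    ⟨1 - b⁻¹ * (a * fC), add_tsub_cancel_of_le hN⟩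
  have hab : a * (F : Measure Θ) A + b = 1 := by
    rw [← hFA]; exact_mod_cast hb
  have hbind : ((F : Measure Θ).restrict C).bind (fun v => (segment F A a b hab v : Measure Θ))
      = (fC * a) • (F : Measure Θ).restrict A + b • (F : Measure Θ).restrict C := by
    rw [bind_segment, Measure.restrict_apply_univ, ← hFC, ← ENNReal.coe_mul]
    rfl
  have hfin : IsFiniteMeasure
      (((F : Measure Θ).restrict C).bind fun v => (segment F A a b hab v : Measure Θ)) := by
    rw [hbind]; infer_instance
  have hmean : Integrable (fun v : Θ => (v : ℝ))
      (((F : Measure Θ).restrict C).bind fun v => (segment F A a b hab v : Measure Θ)) := by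
    rw [hbind]
    exact (Integrable.restrict hF).smul_measure_nnreal.add_measure
      (Integrable.restrict hF).smul_measure_nnreal
  set I := ∫ v in A, ((v : ℝ) - c) ∂(F : Measure Θ) with hI
  set J := ∫ v in C, ((v : ℝ) - c) ∂(F : Measure Θ) with hJ
  have hintc : Integrable (fun v : Θ => (v : ℝ) - c) (F : Measure Θ) :=
    Integrable.sub hF (integrable_const c)
  have h1 := Attainable.of_family hu (measurable_segment (h := hab)) hmean
    (g := fun v => a * (I - ((v : ℝ) - c) * fA))
    (((integrable_const I).sub (hintc.restrict.mul_const _)).const_mul _) (by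
      refine (ae_restrict_iff' hCm).2 (ae_of_all _ fun v hv => ?_)
      have hsv : s ≤ (v : ℝ) := hv.1
      have hvt : (v : ℝ) < t := not_le.1 hv.2
      have hAv : A ⊆ tail Θ v := tail_anti hvt.le
      have := hu.le_segment (h := hab) hF hR (v := v) hAv (by linarith) (by linarith) (by linarith)
      rwa [setIntegral_max_sub hAm hAv, integral_sub_const_restrict hF A v c, hFAr] at this)
  have h2 := (h1.smul b⁻¹).add hu (hmean.smul_measure_nnreal)
    (Integrable.restrict hF).smul_measure_nnreal (h.smul q)
  have hmeas : b⁻¹ • (((F : Measure Θ).restrict C).bind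
      fun v => (segment F A a b hab v : Measure Θ)) + q • (F : Measure Θ).restrict A
      = (F : Measure Θ).restrict (tail Θ s) := by
    rw [hbind, ← hunion, Measure.restrict_union hdisj hCm, smul_add, smul_smul, smul_smul,
      inv_mul_cancel₀ hb0, one_smul, add_right_comm, ← add_smul, mul_comm fC, hq, one_smul]
  rw [hmeas] at h2
  refine h2.mono ?_
  have hI' : ∫ v in tail Θ s, ((v : ℝ) - c) ∂(F : Measure Θ) = I + J := by
    rw [← hunion, setIntegral_union hdisj hCm hintc.integrableOn hintc.integrableOn]
  have hJle : J ≤ (t - c) * fC := by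
    have : J ≤ ∫ _ in C, (t - c) ∂(F : Measure Θ) := by
      refine setIntegral_mono_on hintc.integrableOn (integrable_const _) hCm fun v hv => ?_
      have hvt : (v : ℝ) < t := not_le.1 hv.2
      linarith
    rwa [setIntegral_const, hFCr, smul_eq_mul, mul_comm] at this
  have hg : ∫ v in C, a * (I - ((v : ℝ) - c) * fA) ∂(F : Measure Θ)
      = a * (I * fC - J * fA) := by
    rw [integral_const_mul, integral_sub (integrable_const _) (hintc.restrict.mul_const _),
      setIntegral_const, integral_mul_const, hFCr, smul_eq_mul, mul_comm (fC : ℝ) I]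
  rw [hI', hg]
  have hbr : (a : ℝ) * fA + b = 1 := by exact_mod_cast hb
  have hqr : (b : ℝ)⁻¹ * (a * fC) + q = 1 := by exact_mod_cast hq
  have hbpos : (0 : ℝ) < b := NNReal.coe_pos.2 (pos_iff_ne_zero.2 hb0)
  set n : ℝ := (b : ℝ)⁻¹ with hn
  have hnb : n * b = 1 := inv_mul_cancel₀ hbpos.ne'
  have hn0 : 0 ≤ n := inv_nonneg.2 hbpos.le
  -- Why the loss stays `L`: the new segments leave Sally `n * J`, whereas the part of `A` they
  -- absorb no longer incurs its old loss `n * a * fC * L`. This bound makes the saving cover the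
  -- cost.
  have haL : t - c ≤ a * L := by
    rw [ha, div_mul_eq_mul_div, le_div_iff₀ hR0]
    exact hL
  have h3 : J ≤ a * fC * L := by
    have := mul_le_mul_of_nonneg_right haL fC.2
    calc J ≤ (t - c) * fC := hJle
      _ ≤ a * L * fC := this
      _ = _ := by ring
  have h4 := mul_le_mul_of_nonneg_left h3 hn0
  have hq' : (q : ℝ) = 1 - n * (a * fC) := by linarith
  have hA' : n * (a * fA) = n - 1 := by
    have : (a : ℝ) * fA = 1 - b := by linarith
    rw [this, mul_sub, hnb, mul_one]
  rw [NNReal.coe_inv, hq']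
  have e : n * (a * (I * fC - J * fA)) + (1 - n * (a * fC)) * (I - L)
      = I - J * (n * (a * fA)) - L + n * (a * fC * L) := by ring
  rw [← hn, e, hA']
  linarith

/-- Every type can be revealed. -/
lemma Attainable.reveal (hu : IsBuyerPayoff c u) (hF : FiniteMean F) (A : Set Θ) :
    Attainable u ((F : Measure Θ).restrict A) 0 := by
  -- With coefficients `0` and `1` the segments are point masses.
  have h : ((0 : ℝ≥0) : ℝ≥0∞) * (F : Measure Θ) A + ((1 : ℝ≥0) : ℝ≥0∞) = 1 := by simp
  have hbind : ((F : Measure Θ).restrict A).bind (fun v => (segment F A 0 1 h v : Measure Θ))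
      = (F : Measure Θ).restrict A := by
    rw [bind_segment]; simp
  have hfin : IsFiniteMeasure
      (((F : Measure Θ).restrict A).bind fun v => (segment F A 0 1 h v : Measure Θ)) := by
    rw [hbind]; infer_instance
  have := Attainable.of_family hu (measurable_segment (h := h)) (μ := (F : Measure Θ).restrict A)
    (by rw [hbind]; exact hF.restrict) (integrable_zero _ ℝ _) (ae_of_all _ fun v => hu.nonneg _)
  rw [hbind] at this
  simpa using this

/-- Bob can secure almost the whole welfare in excess of Sally's monopoly profit. -/
theorem Attainable.welfare_sub_profit (hu : IsBuyerPayoff c u) (hF : FiniteMean F) (hc0 : 0 ≤ c)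
    {s : ℝ} (hs0 : 0 ≤ s)
    (hR : ∀ p, c ≤ p → (p - c) * (F : Measure Θ).real (tail Θ p)
      ≤ (s - c) * (F : Measure Θ).real (tail Θ s))
    (hR0 : 0 < (s - c) * (F : Measure Θ).real (tail Θ s)) {δ : ℝ} (hδ : 0 < δ) :
    Attainable u (F : Measure Θ) (∫ v : Θ, max ((v : ℝ) - c) 0 ∂(F : Measure Θ)
      - (s - c) * (F : Measure Θ).real (tail Θ s) - δ) := by
  -- The error `δ` is split in two: `ε * R = δ / 2` pays for the geometric steps, and the other half
  -- for the types just above `c` that are never reached. The ratio `r = (1 + ε)⁻¹` makes the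
  -- hypothesis `hL` of `Attainable.tail_step` an equality.
  set R := (s - c) * (F : Measure Θ).real (tail Θ s) with hRdef
  have hpos : 0 < (F : Measure Θ).real (tail Θ s) :=
    lt_of_le_of_ne measureReal_nonneg fun h => by rw [hRdef, ← h, mul_zero] at hR0; exact hR0.false
  have hcs : c < s := sub_pos.1 (pos_of_mul_pos_left hR0 hpos.le)
  set ε := δ / (2 * R) with hε
  have hε0 : 0 < ε := by positivity
  have hεR : (1 + ε) * R = R + δ / 2 := by rw [hε]; field_simp
  set r := (1 + ε)⁻¹ with hr
  have hr0 : 0 < r := by positivity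
  have hr1 : r < 1 := inv_lt_one_of_one_lt₀ (by linarith)
  have hw0 : 0 < s - c := by linarith
  have main : ∀ k : ℕ, Attainable u ((F : Measure Θ).restrict (tail Θ (c + (s - c) * r ^ k)))
      (∫ v in tail Θ (c + (s - c) * r ^ k), ((v : ℝ) - c) ∂(F : Measure Θ) - (1 + ε) * R) := by
    intro k
    induction k with
    | zero =>
      rw [pow_zero, mul_one, add_sub_cancel]
      exact (Attainable.tail_price hu hF hs0 hcs hpos hR).mono (by rw [← hRdef]; nlinarith)
    | succ k ih =>
      have hk : 0 < (s - c) * r ^ k := by positivity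
      have hk' : (s - c) * r ^ (k + 1) = (s - c) * r ^ k * r := by ring
      refine Attainable.tail_step hu hF hc0 hR0 (by rw [hk']; nlinarith)
        (by rw [hk']; nlinarith) hR (le_of_eq ?_) ih
      rw [hk', add_sub_cancel_left, add_sub_cancel_left, hr]
      field_simp
  obtain ⟨k, hk⟩ := exists_pow_lt_of_lt_one (show 0 < δ / 2 / (s - c) by positivity) hr1
  rw [lt_div_iff₀ hw0, mul_comm] at hk
  set x := c + (s - c) * r ^ k with hx
  have h1 := (main k).add hu hF.restrict hF.restrict (Attainable.reveal hu hF (tail Θ x)ᶜ)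
  rw [Measure.restrict_add_restrict_compl (measurableSet_tail x)] at h1
  refine h1.mono ?_
  have hxm := measurableSet_tail (Θ := Θ) x
  have hint := integrable_max_sub hF c
  rw [← integral_add_compl hxm hint]
  have hcx : c ≤ x := by have : 0 < (s - c) * r ^ k := by positivity
                         linarith
  rw [setIntegral_max_sub hxm (tail_anti hcx)]
  have : ∫ v in (tail Θ x)ᶜ, max ((v : ℝ) - c) 0 ∂(F : Measure Θ) ≤ δ / 2 := by
    calc _ ≤ ∫ v in (tail Θ x)ᶜ, δ / 2 ∂(F : Measure Θ) := by
          refine setIntegral_mono_on hint.integrableOn (integrable_const _) hxm.compl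
            fun v hv => ?_
          have hvx : (v : ℝ) < x := not_le.1 hv
          exact max_le (by linarith) (by linarith)
      _ ≤ δ / 2 := by
          rw [setIntegral_const, smul_eq_mul]
          exact mul_le_of_le_one_left (by linarith) measureReal_le_one
  linarith

end

/-! ### Full revelation and efficient welfare under refinements. -/

/-- A nonintegrable summand has integral `0` by convention, which only helps. This serves round `0`,
where the price need not be measurable in Sally's type. -/
lemma integral_add_le_of_add_le {α : Type*} [MeasurableSpace α] {μ : Measure α} {f g h : α → ℝ}
    (hf : ∀ x, 0 ≤ f x) (hg : ∀ x, 0 ≤ g x) (hfg : ∀ x, f x + g x ≤ h x) (hh : Integrable h μ) :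
    ∫ x, f x ∂μ + ∫ x, g x ∂μ ≤ ∫ x, h x ∂μ := by
  by_cases hfi : Integrable f μ
  · by_cases hgi : Integrable g μ
    · rw [← integral_add hfi hgi]
      exact integral_mono (hfi.add hgi) hh hfg
    · rw [integral_undef hgi, add_zero]
      exact integral_mono hfi hh fun x => by have := hg x; have := hfg x; linarith
  · rw [integral_undef hfi, zero_add]
    exact integral_mono_of_nonneg (ae_of_all _ hg) hh
      (ae_of_all _ fun x => by have := hf x; have := hfg x; linarith)

/-- The point mass at a type. -/
noncomputable def pointMass (c : Θ) : Distr Θ := ⟨Measure.dirac c, inferInstance⟩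

lemma measurable_pointMass : Measurable (pointMass : Θ → Distr Θ) :=
  Measurable.subtype_mk Measure.measurable_dirac

/-- The refinement that reveals the type. -/
noncomputable def fullRevelation (D : Distr Θ) : ProbabilityMeasure (Distr Θ) :=
  ⟨(D : Measure Θ).map pointMass, Measure.isProbabilityMeasure_map measurable_pointMass.aemeasurable⟩

lemma refines_fullRevelation (D : Distr Θ) : Refines (fullRevelation D) D := by
  change ((D : Measure Θ).map pointMass).bind (fun D : Distr Θ => (D : Measure Θ)) = D
  rw [Measure.bind, Measure.map_map measurable_distr_coe measurable_pointMass]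
  exact Measure.bind_dirac

/-- Makes the equilibrium conditions available at almost every posterior. -/
lemma Refines.ae_finiteMean {M : ProbabilityMeasure (Distr Θ)} {D : Distr Θ} (h : Refines M D)
    (hD : FiniteMean D) : ∀ᵐ D' : Distr Θ ∂(M : Measure (Distr Θ)), FiniteMean D' :=
  ae_integrable_of_bind h hD

section Welfare

lemma integrable_gain (hS0 : ∀ θ ∈ ΘS, 0 ≤ θ) (DS : Distr ΘS) {DB : Distr ΘB}
    (hDB : FiniteMean DB) :
    Integrable (fun p : ΘS × ΘB => max ((p.2 : ℝ) - p.1) 0)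
      ((DS : Measure ΘS).prod (DB : Measure ΘB)) := by
  refine Integrable.mono' (Integrable.comp_snd (Integrable.abs hDB) (DS : Measure ΘS))
    (by fun_prop) (ae_of_all _ fun p => ?_)
  rw [Real.norm_of_nonneg (le_max_right _ _)]
  exact max_le ((sub_le_self _ (hS0 _ p.1.2)).trans (le_abs_self _)) (abs_nonneg _)

lemma integrable_welfare_seller (hS0 : ∀ θ ∈ ΘS, 0 ≤ θ) (DS : Distr ΘS) {DB : Distr ΘB}
    (hDB : FiniteMean DB) :
    Integrable (fun c : ΘS => ∫ v : ΘB, max ((v : ℝ) - c) 0 ∂(DB : Measure ΘB))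
      (DS : Measure ΘS) :=
  (integrable_gain hS0 DS hDB).integral_prod_left

lemma integrable_welfare_buyer (hS0 : ∀ θ ∈ ΘS, 0 ≤ θ) (DS : Distr ΘS) {DB : Distr ΘB}
    (hDB : FiniteMean DB) :
    Integrable (fun v : ΘB => ∫ c : ΘS, max ((v : ℝ) - c) 0 ∂(DS : Measure ΘS))
      (DB : Measure ΘB) :=
  (integrable_gain hS0 DS hDB).integral_prod_right

lemma efficientWelfare_swap (hS0 : ∀ θ ∈ ΘS, 0 ≤ θ) (DS : Distr ΘS) {DB : Distr ΘB}
    (hDB : FiniteMean DB) :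
    efficientWelfare DS DB
      = ∫ v : ΘB, ∫ c : ΘS, max ((v : ℝ) - c) 0 ∂(DS : Measure ΘS) ∂(DB : Measure ΘB) :=
  integral_integral_swap (f := fun (c : ΘS) (v : ΘB) => max ((v : ℝ) - c) 0)
    (integrable_gain hS0 DS hDB)

lemma Refines.integrable_efficientWelfare_seller (hS0 : ∀ θ ∈ ΘS, 0 ≤ θ) {DS : Distr ΘS}
    {DB : Distr ΘB} (hDB : FiniteMean DB) {M : ProbabilityMeasure (Distr ΘS)}
    (h : Refines M DS) :
    Integrable (fun DS' => efficientWelfare DS' DB) (M : Measure (Distr ΘS)) :=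
  integrable_integral_of_bind h (integrable_welfare_seller hS0 DS hDB)

lemma Refines.integral_efficientWelfare_seller (hS0 : ∀ θ ∈ ΘS, 0 ≤ θ) {DS : Distr ΘS}
    {DB : Distr ΘB} (hDB : FiniteMean DB) {M : ProbabilityMeasure (Distr ΘS)}
    (h : Refines M DS) :
    ∫ DS', efficientWelfare DS' DB ∂(M : Measure (Distr ΘS)) = efficientWelfare DS DB :=
  integral_of_bind h (integrable_welfare_seller hS0 DS hDB)

/-- With Bob's type outermost, welfare is an integral against his belief and averages over
refinements; the swap needs a finite mean, hence only almost everywhere. -/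
lemma Refines.efficientWelfare_buyer_ae (hS0 : ∀ θ ∈ ΘS, 0 ≤ θ) {DS : Distr ΘS}
    {DB : Distr ΘB} (hDB : FiniteMean DB) {M : ProbabilityMeasure (Distr ΘB)}
    (h : Refines M DB) :
    (fun DB' : Distr ΘB =>
        ∫ v : ΘB, ∫ c : ΘS, max ((v : ℝ) - c) 0 ∂(DS : Measure ΘS) ∂(DB' : Measure ΘB))
      =ᵐ[(M : Measure (Distr ΘB))] fun DB' => efficientWelfare DS DB' := by
  filter_upwards [h.ae_finiteMean hDB] with DB' h'
  exact (efficientWelfare_swap hS0 DS h').symm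

lemma Refines.integrable_efficientWelfare_buyer (hS0 : ∀ θ ∈ ΘS, 0 ≤ θ) {DS : Distr ΘS}
    {DB : Distr ΘB} (hDB : FiniteMean DB) {M : ProbabilityMeasure (Distr ΘB)}
    (h : Refines M DB) :
    Integrable (fun DB' => efficientWelfare DS DB') (M : Measure (Distr ΘB)) :=
  (integrable_integral_of_bind h (integrable_welfare_buyer hS0 DS hDB)).congr
    (h.efficientWelfare_buyer_ae hS0 hDB)

lemma Refines.integral_efficientWelfare_buyer (hS0 : ∀ θ ∈ ΘS, 0 ≤ θ) {DS : Distr ΘS}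
    {DB : Distr ΘB} (hDB : FiniteMean DB) {M : ProbabilityMeasure (Distr ΘB)}
    (h : Refines M DB) :
    ∫ DB', efficientWelfare DS DB' ∂(M : Measure (Distr ΘB)) = efficientWelfare DS DB := by
  rw [← integral_congr_ae (h.efficientWelfare_buyer_ae hS0 hDB),
    integral_of_bind h (integrable_welfare_buyer hS0 DS hDB), efficientWelfare_swap hS0 DS hDB]

end Welfare

/-! ### Monotonicity and bounds for equilibrium payoffs. -/

namespace Protocol

variable {P : Protocol ΘS ΘB}

lemma payoff_succ_odd {t : ℕ} (ht : Odd (t + 1)) (i : Agent) (DS : Distr ΘS) (DB : Distr ΘB) :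
    P.payoff (t + 1) i DS DB = P.expB t i DS (P.msgB (t + 1) DS DB) := by
  rw [payoff, if_pos ht]; rfl

lemma payoff_succ_even {t : ℕ} (ht : Even (t + 1)) (i : Agent) (DS : Distr ΘS) (DB : Distr ΘB) :
    P.payoff (t + 1) i DS DB = P.expS t i DB (P.msgS (t + 1) DS DB) := by
  rw [payoff, if_neg (Nat.not_odd_iff_even.2 ht)]; rfl

lemma payoff_zero_pointMass (i : Agent) (c : ΘS) (DB : Distr ΘB) :
    P.payoff 0 i (pointMass c) DB = expUtility i (P.price c DB) c DB :=
  integral_dirac (fun θ : ΘS => expUtility i (P.price θ DB) θ DB) c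

namespace IsEquilibrium

lemma payoff_le_succ (hP : P.IsEquilibrium) (t : ℕ) (i : Agent) (DS : Distr ΘS) {DB : Distr ΘB}
    (hDB : FiniteMean DB) : P.payoff t i DS DB ≤ P.payoff (t + 1) i DS DB := by
  rcases Nat.even_or_odd (t + 1) with h | h
  · rw [payoff_succ_even h]
    exact (hP.msgS_opt t h DS DB hDB).1.2 i
  · rw [payoff_succ_odd h]
    exact (hP.msgB_opt t h DS DB hDB).1.2 i

lemma payoff_mono (hP : P.IsEquilibrium) (i : Agent) (DS : Distr ΘS) {DB : Distr ΘB}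
    (hDB : FiniteMean DB) : Monotone fun t => P.payoff t i DS DB :=
  monotone_nat_of_le_succ fun t => hP.payoff_le_succ t i DS hDB

/-- Sally can post her own cost, an admissible price because costs are nonnegative. -/
lemma expUtility_nonneg (hP : P.IsEquilibrium) (hS0 : ∀ θ ∈ ΘS, 0 ≤ θ) (i : Agent) (c : ΘS)
    {DB : Distr ΘB} (hDB : FiniteMean DB) : 0 ≤ expUtility i (P.price c DB) c DB := by
  cases i
  · refine le_trans ?_ ((hP.price_opt c DB hDB).2.1 c (hS0 c c.2))
    dsimp only
    rw [expUtility_S_eq, sub_self, zero_mul]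
  · exact expUtility_B_nonneg _ _ _

lemma payoff_nonneg (hP : P.IsEquilibrium) (hS0 : ∀ θ ∈ ΘS, 0 ≤ θ) (t : ℕ) (i : Agent)
    (DS : Distr ΘS) {DB : Distr ΘB} (hDB : FiniteMean DB) : 0 ≤ P.payoff t i DS DB :=
  le_trans (integral_nonneg fun c => hP.expUtility_nonneg hS0 i c hDB)
    (hP.payoff_mono i DS hDB (Nat.zero_le t))

lemma payoff_add_le (hP : P.IsEquilibrium) (hS0 : ∀ θ ∈ ΘS, 0 ≤ θ) (t : ℕ) (DS : Distr ΘS)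
    {DB : Distr ΘB} (hDB : FiniteMean DB) :
    P.payoff t .S DS DB + P.payoff t .B DS DB ≤ efficientWelfare DS DB := by
  induction t generalizing DS DB with
  | zero =>
    exact integral_add_le_of_add_le (fun c => hP.expUtility_nonneg hS0 .S c hDB)
      (fun c => hP.expUtility_nonneg hS0 .B c hDB) (fun c => expUtility_add_le _ _ _ hDB)
      (integrable_welfare_seller hS0 DS hDB)
  | succ t ih =>
    rcases Nat.even_or_odd (t + 1) with h | h
    · have hM := P.msgS_refines (t + 1) DS DB
      have hi := hP.integrableS t h DS DB hDB _ hM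
      rw [payoff_succ_even h, payoff_succ_even h, expS, expS, ← integral_add (hi .S) (hi .B),
        ← hM.integral_efficientWelfare_seller hS0 hDB]
      exact integral_mono ((hi .S).add (hi .B)) (hM.integrable_efficientWelfare_seller hS0 hDB)
        fun DS' => ih DS' hDB
    · have hM := P.msgB_refines (t + 1) DS DB
      have hi := hP.integrableB t h DS DB hDB _ hM
      rw [payoff_succ_odd h, payoff_succ_odd h, expB, expB, ← integral_add (hi .S) (hi .B),
        ← hM.integral_efficientWelfare_buyer hS0 hDB]
      refine integral_mono_ae ((hi .S).add (hi .B))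
        (hM.integrable_efficientWelfare_buyer hS0 hDB) ?_
      filter_upwards [hM.ae_finiteMean hDB] with DB' h'
      exact ih DS h'

lemma price_optimal (hP : P.IsEquilibrium) (c : ΘS) {DB : Distr ΘB} (hDB : FiniteMean DB) {p : ℝ}
    (hp : 0 ≤ p) : (p - c) * (DB : Measure ΘB).real (tail ΘB p)
      ≤ (P.price c DB - c) * (DB : Measure ΘB).real (tail ΘB (P.price c DB)) := by
  rw [← expUtility_S_eq, ← expUtility_S_eq]
  exact (hP.price_opt c DB hDB).2.1 p hp

/-! ### Known cost, and the two-round argument. -/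

/-- Bob's payoff if Sally's cost is commonly known. -/
lemma isBuyerPayoff (hP : P.IsEquilibrium) (c : ΘS) :
    IsBuyerPayoff (c : ℝ) fun DB : Distr ΘB => P.payoff 0 .B (pointMass c) DB where
  nonneg DB := by
    rw [payoff_zero_pointMass]
    exact expUtility_B_nonneg _ _ _
  le_of_optimal DB hDB a ha h := by
    rw [payoff_zero_pointMass, ← expUtility_B_eq a c]
    -- A price optimal for Sally ties with the equilibrium price, and the tie is broken in Bob's
    -- favour.
    refine (hP.price_opt c DB hDB).2.2 a ha (le_antisymm ?_ ?_)
    · exact (hP.price_opt c DB hDB).2.1 a ha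
    · dsimp only
      rw [expUtility_S_eq, expUtility_S_eq]
      exact h _ (hP.price_opt c DB hDB).1
  integrable DB hDB M hM := hP.integrableB 0 (by decide) _ DB hDB M hM .B

/-- Information cannot hurt Sally: she may keep the old price at every posterior, which yields the
old profit on average. -/
lemma le_expB_seller (hP : P.IsEquilibrium) (c : ΘS) {DB : Distr ΘB} (hDB : FiniteMean DB)
    {M : ProbabilityMeasure (Distr ΘB)} (hM : Refines M DB) :
    P.payoff 0 .S (pointMass c) DB ≤ P.expB 0 .S (pointMass c) M := by
  have hu : Integrable (fun v : ΘB => utility .S (P.price c DB) c v) (DB : Measure ΘB) := by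
    simp only [utility_S_eq]
    exact (integrable_const _).indicator (measurableSet_tail _)
  rw [payoff_zero_pointMass, expUtility, ← integral_of_bind hM hu, expB]
  refine integral_mono_ae (integrable_integral_of_bind hM hu)
    (hP.integrableB 0 (by decide) _ DB hDB M hM .S) ?_
  filter_upwards [hM.ae_finiteMean hDB] with DB' h'
  rw [payoff_zero_pointMass]
  exact (hP.price_opt c DB' h').2.1 _ (hP.price_opt c DB hDB).1

/-- Sally is never hurt, so a refinement is either voluntary or worse for Bob than silence. -/
lemma expB_buyer_le (hP : P.IsEquilibrium) (c : ΘS) {DB : Distr ΘB} (hDB : FiniteMean DB)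
    {M : ProbabilityMeasure (Distr ΘB)} (hM : Refines M DB) :
    P.expB 0 .B (pointMass c) M ≤ P.payoff 1 .B (pointMass c) DB := by
  rcases le_total (P.expB 0 .B (pointMass c) M) (P.payoff 0 .B (pointMass c) DB) with h | h
  · exact h.trans (hP.payoff_le_succ 0 .B _ hDB)
  · rw [payoff_succ_odd (by decide)]
    refine (hP.msgB_opt 0 (by decide) (pointMass c) DB hDB).2.1 M ⟨hM, fun i => ?_⟩
    cases i
    · exact hP.le_expB_seller c hDB hM
    · exact h

/-- If Sally's cost is commonly known, one message of Bob makes trade efficient. -/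
lemma payoff_one_pointMass (hP : P.IsEquilibrium) (hS0 : ∀ θ ∈ ΘS, 0 ≤ θ) (c : ΘS)
    {DB : Distr ΘB} (hDB : FiniteMean DB) :
    ∫ v : ΘB, max ((v : ℝ) - c) 0 ∂(DB : Measure ΘB)
      ≤ P.payoff 1 .S (pointMass c) DB + P.payoff 1 .B (pointMass c) DB := by
  have hc0 : 0 ≤ (c : ℝ) := hS0 c c.2
  have hS := hP.payoff_le_succ 0 .S (pointMass c) hDB
  rw [payoff_zero_pointMass, expUtility_S_eq, zero_add] at hS
  set R := (P.price c DB - c) * (DB : Measure ΘB).real (tail ΘB (P.price c DB)) with hR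
  -- Without positive profit, no price above `c` sells with positive probability, so there are no
  -- gains from trade.
  rcases le_or_gt R 0 with h0 | h0
  · have hle : ∀ᵐ v : ΘB ∂(DB : Measure ΘB), (v : ℝ) ≤ c := by
      have : ∀ n : ℕ, ∀ᵐ v : ΘB ∂(DB : Measure ΘB), (v : ℝ) < c + 1 / ((n : ℝ) + 1) := by
        intro n
        have hn : (0 : ℝ) < 1 / ((n : ℝ) + 1) := by positivity
        have h1 := (hP.price_optimal c hDB (p := c + 1 / ((n : ℝ) + 1)) (by linarith)).trans h0
        rw [add_sub_cancel_left] at h1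
        have h2 : (DB : Measure ΘB).real (tail ΘB (c + 1 / ((n : ℝ) + 1))) = 0 :=
          le_antisymm (nonpos_of_mul_nonpos_right h1 hn) measureReal_nonneg
        rw [measureReal_eq_zero_iff] at h2
        rw [ae_iff]
        simpa only [not_lt, tail] using h2
      filter_upwards [ae_all_iff.2 this] with v hv
      refine le_of_forall_pos_le_add fun e he => ?_
      obtain ⟨n, hn⟩ := exists_nat_one_div_lt he
      linarith [hv n]
    have : ∫ v : ΘB, max ((v : ℝ) - c) 0 ∂(DB : Measure ΘB) = 0 := by
      refine integral_eq_zero_of_ae ?_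
      filter_upwards [hle] with v hv
      exact max_eq_right (sub_nonpos.2 hv)
    rw [this]
    exact add_nonneg (hP.payoff_nonneg hS0 _ _ _ hDB) (hP.payoff_nonneg hS0 _ _ _ hDB)
  · suffices ∫ v : ΘB, max ((v : ℝ) - c) 0 ∂(DB : Measure ΘB) - R
        ≤ P.payoff 1 .B (pointMass c) DB by linarith
    refine le_of_forall_pos_le_add fun δ hδ => ?_
    obtain ⟨M, hM, hb⟩ := Attainable.welfare_sub_profit (hP.isBuyerPayoff c) hDB hc0
      (hP.price_opt c DB hDB).1 (fun p hp => hP.price_optimal c hDB (hc0.trans hp)) h0 hδ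
    have hprob : IsProbabilityMeasure M := ⟨by rw [univ_of_bind hM, measure_univ]⟩
    have : ∫ D, P.payoff 0 .B (pointMass c) D ∂M ≤ P.payoff 1 .B (pointMass c) DB :=
      hP.expB_buyer_le c hDB (M := ⟨M, hprob⟩) hM
    rw [← hR] at hb
    have h3 := hb.trans this
    linarith

lemma expS_fullRevelation (hP : P.IsEquilibrium) {t : ℕ} (ht : Even (t + 1)) (i : Agent)
    (DS : Distr ΘS) {DB : Distr ΘB} (hDB : FiniteMean DB) :
    Integrable (fun c => P.payoff t i (pointMass c) DB) (DS : Measure ΘS) ∧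
    P.expS t i DB (fullRevelation DS)
      = ∫ c, P.payoff t i (pointMass c) DB ∂(DS : Measure ΘS) := by
  have h : Integrable (fun DS' => P.payoff t i DS' DB) ((DS : Measure ΘS).map pointMass) :=
    hP.integrableS t ht DS DB hDB _ (refines_fullRevelation DS) i
  exact ⟨h.comp_measurable measurable_pointMass,
    integral_map measurable_pointMass.aemeasurable h.aestronglyMeasurable⟩

/-- If further rounds are useless from the start, full revelation by Sally followed by an optimal
message of Bob is no improvement, so that trade is already efficient. -/
lemma efficient_of_payoff_two_eq (hP : P.IsEquilibrium) (hS0 : ∀ θ ∈ ΘS, 0 ≤ θ) (DS : Distr ΘS)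
    {DB : Distr ΘB} (hDB : FiniteMean DB)
    (h2 : ∀ i, P.payoff 2 i DS DB = P.payoff 0 i DS DB) :
    P.payoff 0 .S DS DB + P.payoff 0 .B DS DB = efficientWelfare DS DB := by
  have heven : Even (1 + 1) := by decide
  have h1 : ∀ i, P.payoff 1 i DS DB = P.payoff 0 i DS DB := fun i =>
    le_antisymm ((hP.payoff_le_succ 1 i DS hDB).trans (h2 i).le) (hP.payoff_le_succ 0 i DS hDB)
  have hfr := fun i => hP.expS_fullRevelation heven i DS hDB
  -- The price depends on Sally's type but not on `DS`, so revelation alone leaves round-`0` payoffs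
  -- unchanged, and Bob's message afterwards hurts nobody.
  have hvol : fullRevelation DS ∈ P.VRS 1 DS DB := by
    refine ⟨refines_fullRevelation DS, fun i => ?_⟩
    rw [h1, (hfr i).2]
    refine integral_mono_of_nonneg (ae_of_all _ fun c => hP.expUtility_nonneg hS0 i c hDB)
      (hfr i).1 (ae_of_all _ fun c => ?_)
    dsimp only
    rw [← payoff_zero_pointMass]
    exact hP.payoff_le_succ 0 i _ hDB
  obtain ⟨-, hS, hB⟩ := hP.msgS_opt 1 heven DS DB hDB
  have e := fun i => (payoff_succ_even (P := P) heven i DS DB).symm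
  have hS' := hS _ hvol
  -- Equality for Sally is needed before tie-breaking can bound Bob's payoff from revelation.
  have hSeq : P.expS 1 .S DB (fullRevelation DS) = P.expS 1 .S DB (P.msgS (1 + 1) DS DB) :=
    le_antisymm hS' (by rw [e, h2, ← h1]; exact hvol.2 .S)
  have hB' := hB _ hvol hSeq
  rw [e, h2, (hfr _).2] at hS' hB'
  refine le_antisymm (hP.payoff_add_le hS0 0 DS hDB) ?_
  calc efficientWelfare DS DB
      ≤ ∫ c, (P.payoff 1 .S (pointMass c) DB + P.payoff 1 .B (pointMass c) DB)
          ∂(DS : Measure ΘS) :=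
        integral_mono (integrable_welfare_seller hS0 DS hDB) ((hfr .S).1.add (hfr .B).1)
          fun c => hP.payoff_one_pointMass hS0 c hDB
    _ = _ := integral_add (hfr .S).1 (hfr .B).1
    _ ≤ _ := add_le_add hS' hB'

end IsEquilibrium

end Protocol

/-! ### Stability passes to almost every posterior. -/

/-- If the lexicographic maximum is already attained by integrals of the smaller functions `f₁`,
`f₂` against a competitor `M`, then they agree almost everywhere with the larger ones. -/
lemma IsLexMax.ae_eq {α : Type*} [MeasurableSpace α] {M m : ProbabilityMeasure α}
    {E₁ E₂ : ProbabilityMeasure α → ℝ} {s : Set (ProbabilityMeasure α)}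
    (hmax : IsLexMax E₁ E₂ s m) (hM : M ∈ s) {f₁ f₂ g₁ g₂ : α → ℝ}
    (hf₁ : Integrable f₁ (M : Measure α)) (hf₂ : Integrable f₂ (M : Measure α))
    (hg₁ : Integrable g₁ (M : Measure α)) (hg₂ : Integrable g₂ (M : Measure α))
    (h₁ : f₁ ≤ᵐ[(M : Measure α)] g₁) (h₂ : f₂ ≤ᵐ[(M : Measure α)] g₂)
    (hE₁ : E₁ M = ∫ x, g₁ x ∂(M : Measure α)) (hE₂ : E₂ M = ∫ x, g₂ x ∂(M : Measure α))
    (hm₁ : E₁ m = ∫ x, f₁ x ∂(M : Measure α)) (hm₂ : E₂ m = ∫ x, f₂ x ∂(M : Measure α)) :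
    f₁ =ᵐ[(M : Measure α)] g₁ ∧ f₂ =ᵐ[(M : Measure α)] g₂ := by
  obtain ⟨-, hmax₁, hmax₂⟩ := hmax
  have e₁ : E₁ M = E₁ m :=
    le_antisymm (hmax₁ M hM) (by rw [hE₁, hm₁]; exact integral_mono_ae hf₁ hg₁ h₁)
  have e₂ : E₂ M = E₂ m :=
    le_antisymm (hmax₂ M hM e₁) (by rw [hE₂, hm₂]; exact integral_mono_ae hf₂ hg₂ h₂)
  rw [hE₁, hm₁] at e₁
  rw [hE₂, hm₂] at e₂
  exact ⟨(integral_eq_iff_of_ae_le hf₁ hg₁ h₁).1 e₁.symm,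
    (integral_eq_iff_of_ae_le hf₂ hg₂ h₂).1 e₂.symm⟩

namespace Protocol

variable {P : Protocol ΘS ΘB}

/-- At this state, more than `t` rounds are of no use. -/
def IsStable (P : Protocol ΘS ΘB) (t : ℕ) (DS : Distr ΘS) (DB : Distr ΘB) : Prop :=
  ∀ n, t ≤ n → ∀ i, P.payoff n i DS DB = P.payoff t i DS DB

namespace IsEquilibrium

/-- Only horizons of the same parity are compared, because the same agent must speak first;
monotonicity fills the gaps. -/
lemma isStable_of_frequently (hP : P.IsEquilibrium) {t : ℕ} {DS : Distr ΘS} {DB : Distr ΘB}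
    (hDB : FiniteMean DB) (h : ∀ k i, P.payoff (t + 2 * k) i DS DB = P.payoff t i DS DB) :
    P.IsStable t DS DB := fun n hn i =>
  le_antisymm ((hP.payoff_mono i DS hDB (show n ≤ t + 2 * (n - t) by omega)).trans (h _ i).le)
    (hP.payoff_mono i DS hDB hn)

/-- Reusing `M` in round `t + 2 * k + 1` is voluntary and, posterior by posterior, weakly better
than in round `t + 1`. Stability says that the optimum there is no better, so `IsLexMax.ae_eq` gives
equality almost everywhere, simultaneously for the countably many `k`. -/
lemma ae_isStable_msgS (hP : P.IsEquilibrium) {t : ℕ} (ht : Even (t + 1)) {DS : Distr ΘS}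
    {DB : Distr ΘB} (hDB : FiniteMean DB) (h : P.IsStable (t + 1) DS DB) :
    ∀ᵐ DS' ∂(P.msgS (t + 1) DS DB : Measure (Distr ΘS)), P.IsStable t DS' DB := by
  set M := P.msgS (t + 1) DS DB
  have hM : Refines M DS := P.msgS_refines _ _ _
  have hroot : ∀ i, P.payoff (t + 1) i DS DB = P.expS t i DB M := fun i => payoff_succ_even ht i _ _
  have main : ∀ k i, ∀ᵐ DS' ∂(M : Measure (Distr ΘS)),
      P.payoff (t + 2 * k) i DS' DB = P.payoff t i DS' DB := by
    intro k
    have hk : Even (t + 2 * k + 1) := by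
      rw [add_right_comm]; exact ht.add (even_two_mul k)
    have hit := hP.integrableS t ht DS DB hDB M hM
    have hik := hP.integrableS _ hk DS DB hDB M hM
    have hle : ∀ i, (fun DS' => P.payoff t i DS' DB) ≤ fun DS' => P.payoff (t + 2 * k) i DS' DB :=
      fun i DS' => hP.payoff_mono i DS' hDB (by omega)
    have hvol : M ∈ P.VRS (t + 2 * k) DS DB := ⟨hM, fun i => by
      refine (hP.payoff_le_succ _ i DS hDB).trans ?_
      rw [h _ (by omega), hroot]
      exact integral_mono (hit i) (hik i) (hle i)⟩
    have e : ∀ i, P.expS (t + 2 * k) i DB (P.msgS (t + 2 * k + 1) DS DB) = P.expS t i DB M :=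
      fun i => by rw [← payoff_succ_even hk, h _ (by omega), hroot]
    have := (hP.msgS_opt _ hk DS DB hDB).ae_eq hvol (hit .S) (hit .B) (hik .S) (hik .B)
      (ae_of_all _ (hle .S)) (ae_of_all _ (hle .B)) rfl rfl (e .S) (e .B)
    intro i
    cases i
    · exact this.1.symm
    · exact this.2.symm
  filter_upwards [ae_all_iff.2 fun k => main k .S, ae_all_iff.2 fun k => main k .B] with DS' h1 h2
  exact hP.isStable_of_frequently hDB fun k i => by cases i; exacts [h1 k, h2 k]

lemma ae_isStable_msgB (hP : P.IsEquilibrium) {t : ℕ} (ht : Odd (t + 1)) {DS : Distr ΘS}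
    {DB : Distr ΘB} (hDB : FiniteMean DB) (h : P.IsStable (t + 1) DS DB) :
    ∀ᵐ DB' ∂(P.msgB (t + 1) DS DB : Measure (Distr ΘB)), P.IsStable t DS DB' := by
  set M := P.msgB (t + 1) DS DB
  have hM : Refines M DB := P.msgB_refines _ _ _
  have hfm := hM.ae_finiteMean hDB
  have hroot : ∀ i, P.payoff (t + 1) i DS DB = P.expB t i DS M := fun i => payoff_succ_odd ht i _ _
  have main : ∀ k i, ∀ᵐ DB' ∂(M : Measure (Distr ΘB)),
      P.payoff (t + 2 * k) i DS DB' = P.payoff t i DS DB' := by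
    intro k
    have hk : Odd (t + 2 * k + 1) := by
      rw [add_right_comm]; exact ht.add_even (even_two_mul k)
    have hit := hP.integrableB t ht DS DB hDB M hM
    have hik := hP.integrableB _ hk DS DB hDB M hM
    have hle : ∀ i, (fun DB' => P.payoff t i DS DB') ≤ᵐ[(M : Measure (Distr ΘB))]
        fun DB' => P.payoff (t + 2 * k) i DS DB' := fun i => by
      filter_upwards [hfm] with DB' h'
      exact hP.payoff_mono i DS h' (by omega)
    have hvol : M ∈ P.VRB (t + 2 * k) DS DB := ⟨hM, fun i => by
      refine (hP.payoff_le_succ _ i DS hDB).trans ?_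
      rw [h _ (by omega), hroot]
      exact integral_mono_ae (hit i) (hik i) (hle i)⟩
    have e : ∀ i, P.expB (t + 2 * k) i DS (P.msgB (t + 2 * k + 1) DS DB) = P.expB t i DS M :=
      fun i => by rw [← payoff_succ_odd hk, h _ (by omega), hroot]
    have := (hP.msgB_opt _ hk DS DB hDB).ae_eq hvol (hit .B) (hit .S) (hik .B) (hik .S)
      (hle .B) (hle .S) rfl rfl (e .B) (e .S)
    intro i
    cases i
    · exact this.2.symm
    · exact this.1.symm
  filter_upwards [hfm, ae_all_iff.2 fun k => main k .S, ae_all_iff.2 fun k => main k .B]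
    with DB' h' h1 h2
  exact hP.isStable_of_frequently h' fun k i => by cases i; exacts [h1 k, h2 k]

theorem efficient_of_isStable (hP : P.IsEquilibrium) (hS0 : ∀ θ ∈ ΘS, 0 ≤ θ) (t : ℕ)
    {DS : Distr ΘS} {DB : Distr ΘB} (hDB : FiniteMean DB) (h : P.IsStable t DS DB) :
    P.payoff t .S DS DB + P.payoff t .B DS DB = efficientWelfare DS DB := by
  induction t generalizing DS DB with
  | zero => exact hP.efficient_of_payoff_two_eq hS0 DS hDB (h 2 (Nat.zero_le _))
  | succ t ih =>
    rcases Nat.even_or_odd (t + 1) with ht | ht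
    · have hM := P.msgS_refines (t + 1) DS DB
      have hi := hP.integrableS t ht DS DB hDB _ hM
      rw [payoff_succ_even ht, payoff_succ_even ht, expS, expS, ← integral_add (hi .S) (hi .B),
        ← hM.integral_efficientWelfare_seller hS0 hDB]
      refine integral_congr_ae ?_
      filter_upwards [hP.ae_isStable_msgS ht hDB h] with DS' h'
      exact ih hDB h'
    · have hM := P.msgB_refines (t + 1) DS DB
      have hi := hP.integrableB t ht DS DB hDB _ hM
      rw [payoff_succ_odd ht, payoff_succ_odd ht, expB, expB, ← integral_add (hi .S) (hi .B),
        ← hM.integral_efficientWelfare_buyer hS0 hDB]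
      refine integral_congr_ae ?_
      filter_upwards [hP.ae_isStable_msgB ht hDB h, hM.ae_finiteMean hDB] with DB' h' hf
      exact ih hf h'

/-! ### From message complexity to stability. -/

lemma tendsto_payoff (hP : P.IsEquilibrium) (hS0 : ∀ θ ∈ ΘS, 0 ≤ θ) (i : Agent) (DS : Distr ΘS)
    {DB : Distr ΘB} (hDB : FiniteMean DB) :
    Tendsto (fun n => P.payoff n i DS DB) atTop (𝓝 (P.payoffE ⊤ i DS DB)) := by
  refine tendsto_nhds_limUnder ⟨_, tendsto_atTop_ciSup (hP.payoff_mono i DS hDB)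
    ⟨efficientWelfare DS DB, ?_⟩⟩
  rintro _ ⟨n, rfl⟩
  have h1 := hP.payoff_add_le hS0 n DS hDB
  have h2 := hP.payoff_nonneg hS0 n .S DS hDB
  have h3 := hP.payoff_nonneg hS0 n .B DS hDB
  cases i <;> dsimp only <;> linarith

/-- Each payoff is nondecreasing and bounded by its limit, so once the sum reaches the sum of the
limits neither payoff can move. -/
lemma isStable_of_messageComplexity_eq (hP : P.IsEquilibrium) (hS0 : ∀ θ ∈ ΘS, 0 ≤ θ)
    {DS : Distr ΘS} {DB : Distr ΘB} (hDB : FiniteMean DB) {t : ℕ}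
    (ht : P.messageComplexity DS DB = t) : P.IsStable t DS DB := by
  -- The set contains `⊤`, so its infimum is attained.
  have hmem := csInf_mem (s := {t : ℕ∞ | P.payoffE t .S DS DB + P.payoffE t .B DS DB
    = P.payoffE ⊤ .S DS DB + P.payoffE ⊤ .B DS DB}) ⟨⊤, rfl⟩
  change P.messageComplexity DS DB ∈ _ at hmem
  rw [ht] at hmem
  have heq : P.payoff t .S DS DB + P.payoff t .B DS DB
      = P.payoffE ⊤ .S DS DB + P.payoffE ⊤ .B DS DB := hmem
  intro n hn
  have hle := fun i => (hP.payoff_mono i DS hDB).ge_of_tendsto (hP.tendsto_payoff hS0 i DS hDB) n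
  have hS := hP.payoff_mono .S DS hDB hn
  have hB := hP.payoff_mono .B DS hDB hn
  have h1 := hle .S
  have h2 := hle .B
  dsimp only at hS hB h1 h2
  intro i
  cases i <;> linarith

end IsEquilibrium

end Protocol

end BilateralTrade

open BilateralTrade in
theorem theorem1 (ΘS ΘB : Set ℝ) (hΘS : MeasurableSet ΘS) (hΘB : MeasurableSet ΘB)
    (hS0 : ∀ θ ∈ ΘS, 0 ≤ θ) (hB0 : ∀ θ ∈ ΘB, 0 ≤ θ)
    (P : Protocol ΘS ΘB) (hP : P.IsEquilibrium)
    (DS : Distr ΘS) (DB : Distr ΘB) (hDB : FiniteMean DB)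
    (t : ℕ) (ht : P.messageComplexity DS DB = t) :
    P.payoff t .S DS DB + P.payoff t .B DS DB = efficientWelfare DS DB :=
  hP.efficient_of_isStable hS0 t hDB (hP.isStable_of_messageComplexity_eq hS0 hDB ht)
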